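/- Let $k$ be a field and let $(\mathscr{C},\mathbb{E},\mathfrak{s})$ be an extriangulated category (in the sense of Nakaoka and Palu) whose underlying additive category is $k$-linear, Hom-finite and Krull--Schmidt. All subcategories are full and closed under isomorphisms. A conflation is a sequence $A\to B\to C$ that realizes some $\delta\in\mathbb{E}(C,A)$; then $A\to B$ is called an inflation, with cone $C$. For a class $\mathcal{Y}$ of objects of an extriangulated category $\mathscr{D}$, $\mathrm{Filt}_{\mathscr{D}}(\mathcal{Y})$ is the subcategory of all objects $M$ that admit a finite chain of inflations $0=X_0\to X_1\to\cdots\to X_n=M$ in $\mathscr{D}$ with all cones in $\mathcal{Y}$. Let $\mathcal{X}$ be a semibrick in $\mathscr{C}$, i.e. a set of isomorphism classes of objects whose endomorphism rings are division rings, with $\mathrm{Hom}_{\mathscr{C}}(X_1,X_2)=0$ for non-isomorphic $X_1,X_2\in\mathcal{X}$. Let $\mathcal{T}=\mathrm{Filt}_{\mathscr{C}}(\mathcal{X})$ with the restricted extriangulated structure: $\mathbb{E}$ is restricted to $\mathcal{T}$, and the conflations of $\mathcal{T}$ are the conflations of $\mathscr{C}$ with all three terms in $\mathcal{T}$. Assume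 that $\mathcal{T}$ has enough projectives and enough injectives, and let $\mathcal{P}$ be the subcategory of projective objects of $\mathcal{T}$. A filtration subcategory of $\mathcal{T}$ is a subcategory of the form $\mathrm{Filt}_{\mathcal{T}}(\mathcal{S})$ with $\mathcal{S}\subseteq\mathcal{X}$. For a subcategory $\mathcal{U}$ of $\mathcal{T}$ put $\mathcal{U}^{\perp_1}=\{M\in\mathcal{T} : \mathbb{E}(U,M)=0 \text{ for all } U\in\mathcal{U}\}$. A pair $(\mathcal{U},\mathcal{V})$ of subcategories of $\mathcal{T}$ that are closed under direct summands is a cotorsion pair in $\mathcal{T}$ if $\mathbb{E}(U,V)=0$ for all $U\in\mathcal{U}$, $V\in\mathcal{V}$, and every $M\in\mathcal{T}$ admits conflations $V\to U\to M$ and $M\to V'\to U'$ in $\mathcal{T}$ with $U,U'\in\mathcal{U}$ and $V,V'\in\mathcal{V}$. Then for every subcategory $\mathcal{D}$ of $\mathcal{T}$ there is a unique subset $\mathcal{S}_{\mathcal{D}}\subseteq\mathcal{X}$ such that $\mathrm{Filt}_{\mathcal{T}}(\mathcal{S}_{\mathcal{D}})$ is the smallest filtration subcategory of $\mathcal{T}$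 containing $\mathcal{D}$, and the assignments $\mathcal{U}\mapsto\mathcal{S}_{\mathcal{U}}$ and $\mathcal{S}\mapsto\mathrm{Filt}_{\mathcal{T}}(\mathcal{S})$ are mutually inverse bijections between (1) the set of filtration subcategories $\mathcal{U}$ of $\mathcal{T}$ such that $(\mathcal{U},\mathcal{U}^{\perp_1})$ is a cotorsion pair in $\mathcal{T}$, and (2) the set of subsets $\mathcal{S}$ of $\mathcal{X}$ with $\mathcal{S}_{\mathcal{P}}\subseteq\mathcal{S}$. -/

import Mathlib

open CategoryTheory CategoryTheory.Limits Opposite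

universe w v u

/-! ## Extriangulated categories -/

/-- The data `(𝔼, 𝔰)` on an additive category `C`: a functor `𝔼 : Cᵒᵖ × C ⥤ Ab` (written in curried
form) and the relation "the sequence `A ⟶ B ⟶ D` belongs to the class `𝔰(δ)`", for
`δ ∈ 𝔼(D, A)`. The axioms are in `ExtData.IsExtriangulated`. -/
structure ExtData (C : Type u) [Category.{v} C] where
  E : Cᵒᵖ ⥤ C ⥤ AddCommGrpCat.{w}
  Realizes : ∀ {A B D : C}, ((E.obj (op D)).obj A) → (A ⟶ B) → (B ⟶ D) → Prop

namespace ExtData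

/-- Two sequences `A ⟶ B ⟶ D` and `A ⟶ B' ⟶ D` are equivalent. -/
def SeqEquiv {C : Type u} [Category.{v} C] {A B B' D : C}
    (x : A ⟶ B) (y : B ⟶ D) (x' : A ⟶ B') (y' : B' ⟶ D) : Prop :=
  ∃ b : B ≅ B', x ≫ b.hom = x' ∧ b.hom ≫ y' = y

section Basic

variable {C : Type u} [Category.{v} C] (𝓔 : ExtData.{w} C)

/-- The group `𝔼(D, A)` of extensions. -/
abbrev Ext (D A : C) : Type w := (𝓔.E.obj (op D)).obj A

/-- `a_* δ = 𝔼(D, a)(δ)`. -/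
def push {D A A' : C} (a : A ⟶ A') (δ : 𝓔.Ext D A) : 𝓔.Ext D A' :=
  ((𝓔.E.obj (op D)).map a).hom δ

/-- `c^* δ = 𝔼(c, A)(δ)`. -/
def pull {D D' A : C} (c : D' ⟶ D) (δ : 𝓔.Ext D A) : 𝓔.Ext D' A :=
  ((𝓔.E.map c.op).app A).hom δ

/-- `A ⟶ B ⟶ D` is a conflation: it realizes some extension. -/
def Conflation {A B D : C} (x : A ⟶ B) (y : B ⟶ D) : Prop :=
  ∃ δ : 𝓔.Ext D A, 𝓔.Realizes δ x y

/-- Projective objects. -/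
def projectives : ObjectProperty C := fun P =>
  ∀ ⦃A B D : C⦄ (x : A ⟶ B) (y : B ⟶ D), 𝓔.Conflation x y →
    ∀ c : P ⟶ D, ∃ b : P ⟶ B, b ≫ y = c

/-- Injective objects. -/
def injectives : ObjectProperty C := fun I =>
  ∀ ⦃A B D : C⦄ (x : A ⟶ B) (y : B ⟶ D), 𝓔.Conflation x y →
    ∀ a : A ⟶ I, ∃ b : B ⟶ I, x ≫ b = a

/-- For every `M` there is a conflation `A ⟶ P ⟶ M` with `P` projective. -/
def EnoughProj : Prop :=
  ∀ M : C, ∃ (A P : C) (x : A ⟶ P) (y : P ⟶ M), 𝓔.projectives P ∧ 𝓔.Conflation x y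

/-- For every `M` there is a conflation `M ⟶ I ⟶ D` with `I` injective. -/
def EnoughInj : Prop :=
  ∀ M : C, ∃ (I D : C) (x : M ⟶ I) (y : I ⟶ D), 𝓔.injectives I ∧ 𝓔.Conflation x y

/-- The filtration subcategory `Filt(X)`: the objects `M` with a finite chain
`0 = X₀ ⟶ X₁ ⟶ ⋯ ⟶ Xₙ = M` of inflations whose cones lie in `X`. -/
inductive Filt (X : ObjectProperty C) : ObjectProperty C
  | zero (M : C) (h : IsZero M) : Filt X M
  | step {N M D : C} (f : N ⟶ M) (g : M ⟶ D) (hN : Filt X N) (hfg : 𝓔.Conflation f g)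
      (hD : X D) : Filt X M

/-- The right `𝔼`-orthogonal `U^{⊥₁}`: the objects `M` with `𝔼(U, M) = 0`. -/
def rightPerp (U : ObjectProperty C) : ObjectProperty C := fun M =>
  ∀ ⦃N : C⦄, U N → ∀ δ : 𝓔.Ext N M, δ = 0

/-- The structure on a full subcategory `T`: the restriction of `𝔼`, with the same realizations.
(If `T` is extension-closed in an extriangulated category, this is its usual extriangulated
structure.) -/
def restrict (T : ObjectProperty C) : ExtData.{w} T.FullSubcategory where
  E := T.ι.op ⋙ 𝓔.E ⋙ (Functor.whiskeringLeft _ _ _).obj T.ι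
  Realizes {A B D} δ x y :=
    𝓔.Realizes (A := A.obj) (B := B.obj) (D := D.obj) δ x.hom y.hom

end Basic

section Additive

variable {C : Type u} [Category.{v} C] [Preadditive C]

/-- A subcategory closed under direct summands. -/
def SummandClosed (U : ObjectProperty C) : Prop :=
  ∀ ⦃A B : C⦄ (b : BinaryBicone A B), Nonempty b.IsBilimit → U b.pt → U A ∧ U B

/-- `(U, V)` is a cotorsion pair. -/
structure IsCotorsionPair (𝓔 : ExtData.{w} C) (U V : ObjectProperty C) : Prop where
  left_closed : SummandClosed U
  right_closed : SummandClosed V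
  ext_zero : ∀ ⦃M N : C⦄, U M → V N → ∀ δ : 𝓔.Ext M N, δ = 0
  left_approx : ∀ M : C, ∃ (V₀ U₀ : C) (x : V₀ ⟶ U₀) (y : U₀ ⟶ M),
    V V₀ ∧ U U₀ ∧ 𝓔.Conflation x y
  right_approx : ∀ M : C, ∃ (V₀ U₀ : C) (x : M ⟶ V₀) (y : V₀ ⟶ U₀),
    V V₀ ∧ U U₀ ∧ 𝓔.Conflation x y

/-- The direct sum `δ ⊕ δ' ∈ 𝔼(D ⊞ D', A ⊞ A')`, i.e. the element corresponding to
`(δ, 0, 0, δ')`. -/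
noncomputable def extSum [HasBinaryBiproducts C] (𝓔 : ExtData.{w} C) {A D A' D' : C}
    (δ : 𝓔.Ext D A) (δ' : 𝓔.Ext D' A') : 𝓔.Ext (D ⊞ D') (A ⊞ A') :=
  𝓔.push biprod.inl (𝓔.pull biprod.fst δ) + 𝓔.push biprod.inr (𝓔.pull biprod.snd δ')

/-- The axioms of an extriangulated category. -/
structure IsExtriangulated [HasBinaryBiproducts C] (𝓔 : ExtData.{w} C) : Prop where
  /-- (ET1): `𝔼` is biadditive. -/
  additive_right : ∀ D : Cᵒᵖ, (𝓔.E.obj D).Additive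
  additive_left : ∀ A : C, (𝓔.E.flip.obj A).Additive
  /-- `𝔰(δ)` is an equivalence class of sequences: non-empty, and ... -/
  exists_realizes : ∀ ⦃A D : C⦄ (δ : 𝓔.Ext D A), ∃ (B : C) (x : A ⟶ B) (y : B ⟶ D),
    𝓔.Realizes δ x y
  /-- ... containing with a sequence exactly the sequences equivalent to it. -/
  realizes_iff : ∀ ⦃A B B' D : C⦄ (δ : 𝓔.Ext D A) (x : A ⟶ B) (y : B ⟶ D)
    (x' : A ⟶ B') (y' : B' ⟶ D), 𝓔.Realizes δ x y →
      (𝓔.Realizes δ x' y' ↔ SeqEquiv x y x' y')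
  /-- (ET2): `𝔰` is a realization, ... -/
  realization : ∀ ⦃A B D A' B' D' : C⦄ (δ : 𝓔.Ext D A) (δ' : 𝓔.Ext D' A')
    (x : A ⟶ B) (y : B ⟶ D) (x' : A' ⟶ B') (y' : B' ⟶ D'),
    𝓔.Realizes δ x y → 𝓔.Realizes δ' x' y' →
    ∀ (a : A ⟶ A') (c : D ⟶ D'), 𝓔.push a δ = 𝓔.pull c δ' →
      ∃ b : B ⟶ B', x ≫ b = a ≫ x' ∧ y ≫ c = b ≫ y'
  /-- ... and it is additive. -/
  realizes_zero : ∀ A D : C, 𝓔.Realizes (0 : 𝓔.Ext D A)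
    (biprod.inl : A ⟶ A ⊞ D) (biprod.snd : A ⊞ D ⟶ D)
  realizes_sum : ∀ ⦃A B D A' B' D' : C⦄ (δ : 𝓔.Ext D A) (δ' : 𝓔.Ext D' A')
    (x : A ⟶ B) (y : B ⟶ D) (x' : A' ⟶ B') (y' : B' ⟶ D'),
    𝓔.Realizes δ x y → 𝓔.Realizes δ' x' y' →
      𝓔.Realizes (𝓔.extSum δ δ') (biprod.map x x') (biprod.map y y')
  /-- (ET3). -/
  et3 : ∀ ⦃A B D A' B' D' : C⦄ (δ : 𝓔.Ext D A) (δ' : 𝓔.Ext D' A')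
    (x : A ⟶ B) (y : B ⟶ D) (x' : A' ⟶ B') (y' : B' ⟶ D'),
    𝓔.Realizes δ x y → 𝓔.Realizes δ' x' y' →
    ∀ (a : A ⟶ A') (b : B ⟶ B'), x ≫ b = a ≫ x' →
      ∃ c : D ⟶ D', y ≫ c = b ≫ y' ∧ 𝓔.push a δ = 𝓔.pull c δ'
  /-- (ET3)ᵒᵖ. -/
  et3_op : ∀ ⦃A B D A' B' D' : C⦄ (δ : 𝓔.Ext D A) (δ' : 𝓔.Ext D' A')
    (x : A ⟶ B) (y : B ⟶ D) (x' : A' ⟶ B') (y' : B' ⟶ D'),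
    𝓔.Realizes δ x y → 𝓔.Realizes δ' x' y' →
    ∀ (b : B ⟶ B') (c : D ⟶ D'), y ≫ c = b ≫ y' →
      ∃ a : A ⟶ A', x ≫ b = a ≫ x' ∧ 𝓔.push a δ = 𝓔.pull c δ'
  /-- (ET4): the composite of inflations `f : A ⟶ B`, `g : B ⟶ G`. -/
  et4 : ∀ ⦃A B D G F : C⦄ (δ : 𝓔.Ext D A) (δ' : 𝓔.Ext F B)
    (f : A ⟶ B) (f' : B ⟶ D) (g : B ⟶ G) (g' : G ⟶ F),
    𝓔.Realizes δ f f' → 𝓔.Realizes δ' g g' →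
      ∃ (K : C) (d : D ⟶ K) (e : K ⟶ F) (h' : G ⟶ K) (δ'' : 𝓔.Ext K A),
        g ≫ h' = f' ≫ d ∧ h' ≫ e = g' ∧
        𝓔.Realizes δ'' (f ≫ g) h' ∧
        𝓔.Realizes (𝓔.push f' δ') d e ∧
        𝓔.pull d δ'' = δ ∧
        𝓔.push f δ'' = 𝓔.pull e δ'
  /-- (ET4)ᵒᵖ: the composite of deflations `f : A ⟶ B`, `g : B ⟶ G`. -/
  et4_op : ∀ ⦃A B D G F : C⦄ (δ : 𝓔.Ext B D) (δ' : 𝓔.Ext G F)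
    (f' : D ⟶ A) (f : A ⟶ B) (g' : F ⟶ B) (g : B ⟶ G),
    𝓔.Realizes δ f' f → 𝓔.Realizes δ' g' g →
      ∃ (K : C) (d : D ⟶ K) (e : K ⟶ F) (h' : K ⟶ A) (δ'' : 𝓔.Ext G K),
        d ≫ h' = f' ∧ h' ≫ f = e ≫ g' ∧
        𝓔.Realizes δ'' h' (f ≫ g) ∧
        𝓔.Realizes (𝓔.pull g' δ) d e ∧
        𝓔.push e δ'' = δ' ∧
        𝓔.push d δ = 𝓔.pull g δ''

end Additive

end ExtData

/-! ## Krull–Schmidt categories and semibricks -/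

/-- Every object is a finite direct sum of objects with local endomorphism rings. -/
def IsKrullSchmidt (C : Type u) [Category.{v} C] [Preadditive C] [HasFiniteBiproducts C] : Prop :=
  ∀ M : C, ∃ (n : ℕ) (F : Fin n → C),
    (∀ i, IsLocalRing (End (F i))) ∧ Nonempty (M ≅ ⨁ F)

section Semibrick

variable {C : Type u} [Category.{v} C] [Preadditive C]

/-- A brick: the endomorphism ring is a division ring. -/
def IsBrick (M : C) : Prop :=
  Nontrivial (End M) ∧ ∀ f : End M, f ≠ 0 → IsUnit f

/-- A semibrick: a set of isoclasses (encoded as an isomorphism-closed property of objects) of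
bricks with no non-zero morphisms between non-isomorphic members. -/
structure IsSemibrick (X : ObjectProperty C) : Prop where
  iso_closed : X.IsClosedUnderIsomorphisms
  brick : ∀ ⦃M : C⦄, X M → IsBrick M
  hom_zero : ∀ ⦃M N : C⦄, X M → X N → ¬ Nonempty (M ≅ N) → ∀ f : M ⟶ N, f = 0

end Semibrick

namespace ExtData

section Support

variable {C : Type u} [Category.{v} C] (𝓔 : ExtData.{w} C) (X : ObjectProperty C)

/-- The category `T = Filt(X)`. -/
abbrev FiltCat : Type u := (𝓔.Filt X).FullSubcategory

/-- The structure `(𝔼, 𝔰)` on `T = Filt(X)`. -/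
abbrev filtData : ExtData.{w} (𝓔.FiltCat X) := 𝓔.restrict (𝓔.Filt X)

/-- `S` is a subset of `X` (as a set of isoclasses). -/
def IsSubset (S : ObjectProperty C) : Prop :=
  S.IsClosedUnderIsomorphisms ∧ S ≤ X

/-- `Filt_T(S)`, formed inside `T = Filt(X)`. -/
def FiltIn (S : ObjectProperty C) : ObjectProperty (𝓔.FiltCat X) :=
  (𝓔.filtData X).Filt (S.inverseImage (𝓔.Filt X).ι)

/-- The filtration subcategories of `T`: those of the form `Filt_T(S)` with `S ⊆ X`. -/
def IsFiltrationSubcategory (U : ObjectProperty (𝓔.FiltCat X)) : Prop :=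
  ∃ S : ObjectProperty C, IsSubset X S ∧ U = 𝓔.FiltIn X S

/-- `S ⊆ X`, and `Filt_T(S)` is the smallest filtration subcategory of `T` containing `D`. -/
def IsSupport (D : ObjectProperty (𝓔.FiltCat X)) (S : ObjectProperty C) : Prop :=
  IsSubset X S ∧ D ≤ 𝓔.FiltIn X S ∧
    ∀ U : ObjectProperty (𝓔.FiltCat X), 𝓔.IsFiltrationSubcategory X U → D ≤ U →
      𝓔.FiltIn X S ≤ U

/-- `S_D`: the subset of `X` such that `Filt_T(S_D)` is the smallest filtration subcategory of `T`
containing `D`. -/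
noncomputable def support (D : ObjectProperty (𝓔.FiltCat X)) : ObjectProperty C :=
  Classical.epsilon (𝓔.IsSupport X D)

variable [Preadditive C]

/-- The filtration subcategories `U` of `T` such that `(U, U^{⊥₁})` is a cotorsion pair in `T`. -/
def cotorsionFiltrations : Set (ObjectProperty (𝓔.FiltCat X)) :=
  {U | 𝓔.IsFiltrationSubcategory X U ∧
    IsCotorsionPair (𝓔.filtData X) U ((𝓔.filtData X).rightPerp U)}

/-- The subsets `S` of `X` that contain `S_P`, where `P` consists of the projectives of `T`. -/
def subsetsContainingProj : Set (ObjectProperty C) :=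
  {S | IsSubset X S ∧ 𝓔.support X (𝓔.filtData X).projectives ≤ S}

end Support

end ExtData

/-!
Write `T = Filt(X)`. Only the axioms of an extriangulated category, the semibrick condition and the
existence of enough projectives and injectives in `T` are needed.

**Schur's lemma.** Let `S ⊆ X`, let `Y ∈ X` and let `M` have an `S`-filtration of length `n`. A
nonzero morphism `Y ⟶ M` is an inflation, `Y ∈ S`, and its cone has an `S`-filtration of length
less than `n` (`exists_cone`). So the members of `X` behave like simple objects of `T`, although `T`
need not be abelian and inflations need not be monomorphisms. In particular a filtered object can
have a zero morphism as the first step of a filtration. In that case it is a summand of an object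
of smaller length, and one uses that filtered objects of length at most `n` are closed under
summands (`filtLE_of_retract`). That closure is proved together with the splitting of idempotents
(`exists_splitting`), by induction on the length.

**Supports.** Removing one step at a time from an `X`-filtration, these facts show that an object
filtered by each of several subsets of `X` is filtered by their intersection (`filt_sInf`), and that
`Filt(S)` determines `S` (`le_of_filt_le`). Hence `S_D` is the intersection of all subsets `S`
with `D ⊆ Filt(S)`, and the two assignments are inverse to each other on all filtration
subcategories. What remains is that `(Filt(S), Filt(S)^{⊥₁})` is a cotorsion pair exactly when
`Filt(S)` contains the projectives of `T`.

**Cotorsion pairs.** If the pair is a cotorsion pair, each projective is a summand of an object of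
`Filt(S)`. Conversely, by Schur's lemma every `N ∈ T` has a conflation `t ⟶ N ⟶ F` with
`t ∈ Filt(S)` and `Hom(Filt(S), F) = 0` (`exists_torsion`). For a conflation `M ⟶ I ⟶ N` with `I`
injective, the cocone `V` of `I ⟶ N ⟶ F` fits into a conflation `M ⟶ V ⟶ t`, and
`𝔼(Filt(S), V) = 0` by the exact sequence `Hom(U, F) ⟶ 𝔼(U, V) ⟶ 𝔼(U, I)`
(`exists_right_approx`). The conflations `V ⟶ U ⟶ M` follow by a pushout of `K ⟶ P ⟶ M` with `P`
projective along `K ⟶ V` (`isCotorsionPair_filtIn`); here `P ∈ Filt(S)` is used.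
-/

/-! ### Criteria for invertibility -/

namespace CategoryTheory

variable {C : Type u} [Category.{v} C]

theorem isIso_of_isIso_comp_of_isIso_comp {A B : C} (f : A ⟶ B) (g : B ⟶ A) [IsIso (f ≫ g)]
    [IsIso (g ≫ f)] : IsIso f := by
  have e₁ : f ≫ g ≫ inv (f ≫ g) = 𝟙 _ := by rw [← Category.assoc, IsIso.hom_inv_id]
  have e₂ : (inv (g ≫ f) ≫ g) ≫ f = 𝟙 _ := by rw [Category.assoc, IsIso.inv_hom_id]
  have : IsSplitMono f := ⟨⟨⟨_, e₁⟩⟩⟩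
  have : IsSplitEpi f := ⟨⟨⟨_, e₂⟩⟩⟩
  exact isIso_of_mono_of_isSplitEpi f

theorem isIso_of_unipotent [Preadditive C] {A : C} (b : A ⟶ A)
    (e : (𝟙 A - b) ≫ (𝟙 A - b) = 0) : IsIso b := by
  simp only [Preadditive.sub_comp, Preadditive.comp_sub, Category.id_comp, Category.comp_id] at e
  have e' : b ≫ b = b + b - 𝟙 A := by
    rw [← sub_eq_zero, ← e]; abel
  exact ⟨𝟙 A + 𝟙 A - b, by simp [e'], by simp [e']⟩

end CategoryTheory

namespace ExtData

/-! ### Functoriality of extension groups -/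

section Functoriality

variable {C : Type u} [Category.{v} C] {𝓔 : ExtData.{w} C}

theorem push_id {D A : C} (δ : 𝓔.Ext D A) : 𝓔.push (𝟙 A) δ = δ := by
  simp [push]

theorem pull_id {D A : C} (δ : 𝓔.Ext D A) : 𝓔.pull (𝟙 D) δ = δ := by
  simp [pull]

theorem push_comp {D A A' A'' : C} (a : A ⟶ A') (a' : A' ⟶ A'') (δ : 𝓔.Ext D A) :
    𝓔.push (a ≫ a') δ = 𝓔.push a' (𝓔.push a δ) := by
  simp [push]

theorem pull_comp {D D' D'' A : C} (c : D' ⟶ D) (c' : D'' ⟶ D') (δ : 𝓔.Ext D A) :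
    𝓔.pull (c' ≫ c) δ = 𝓔.pull c' (𝓔.pull c δ) := by
  simp [pull]

theorem push_pull {D D' A A' : C} (a : A ⟶ A') (c : D' ⟶ D) (δ : 𝓔.Ext D A) :
    𝓔.push a (𝓔.pull c δ) = 𝓔.pull c (𝓔.push a δ) :=
  (ConcreteCategory.congr_hom ((𝓔.E.map c.op).naturality a) δ).symm

theorem push_zero {D A A' : C} (a : A ⟶ A') : 𝓔.push a (0 : 𝓔.Ext D A) = 0 :=
  map_zero _

theorem pull_zero {D D' A : C} (c : D' ⟶ D) : 𝓔.pull c (0 : 𝓔.Ext D A) = 0 :=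
  map_zero _

theorem pull_add {D D' A : C} (c : D' ⟶ D) (δ δ' : 𝓔.Ext D A) :
    𝓔.pull c (δ + δ') = 𝓔.pull c δ + 𝓔.pull c δ' :=
  map_add _ _ _

end Functoriality

namespace IsExtriangulated

variable {C : Type u} [Category.{v} C] [Preadditive C] [HasBinaryBiproducts C]
  {𝓔 : ExtData.{w} C} (h : 𝓔.IsExtriangulated)

include h

theorem push_zero_hom {D A A' : C} (δ : 𝓔.Ext D A) : 𝓔.push (0 : A ⟶ A') δ = 0 := by
  have := h.additive_right (op D)
  simp [push, Functor.map_zero]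

theorem pull_zero_hom {D D' A : C} (δ : 𝓔.Ext D A) : 𝓔.pull (0 : D' ⟶ D) δ = 0 := by
  have := h.additive_left A
  have e : (𝓔.E.flip.obj A).map (0 : D' ⟶ D).op = 0 := Functor.map_zero _ _ _
  exact ConcreteCategory.congr_hom e δ

theorem pull_sub_hom {D D' A : C} (c c' : D' ⟶ D) (δ : 𝓔.Ext D A) :
    𝓔.pull (c - c') δ = 𝓔.pull c δ - 𝓔.pull c' δ := by
  have := h.additive_left A
  have e : (𝓔.E.flip.obj A).map (c.op - c'.op) =
    (𝓔.E.flip.obj A).map c.op - (𝓔.E.flip.obj A).map c'.op := Functor.map_sub _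
  exact ConcreteCategory.congr_hom e δ

/-! ### Split and trivial conflations -/

/-- A direct sum decomposition `B = A ⊕ D` realizes the zero extension. -/
theorem realizes_zero_of_splitting {A B D : C} (x : A ⟶ B) (r : B ⟶ A) (s : D ⟶ B) (y : B ⟶ D)
    (hxr : x ≫ r = 𝟙 A) (hsy : s ≫ y = 𝟙 D) (hxy : x ≫ y = 0) (hsr : s ≫ r = 0)
    (hB : r ≫ x + y ≫ s = 𝟙 B) : 𝓔.Realizes (0 : 𝓔.Ext D A) x y := by
  refine (h.realizes_iff _ _ _ _ _ (h.realizes_zero A D)).2 ⟨⟨biprod.desc x s, biprod.lift r y,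
    ?_, ?_⟩, ?_, ?_⟩
  · ext <;> simp [hxr, hsy, hxy, hsr]
  · simpa using hB
  · simp
  · ext <;> simp [hsy, hxy]

theorem realizes_id {A Z : C} (hZ : IsZero Z) (y : A ⟶ Z) :
    𝓔.Realizes (0 : 𝓔.Ext Z A) (𝟙 A) y :=
  h.realizes_zero_of_splitting _ (𝟙 A) 0 y (by simp) (hZ.eq_of_src _ _) (hZ.eq_of_tgt _ _)
    (by simp) (by simp)

theorem realizes_id' {A Z : C} (hZ : IsZero Z) (x : Z ⟶ A) :
    𝓔.Realizes (0 : 𝓔.Ext A Z) x (𝟙 A) :=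
  h.realizes_zero_of_splitting _ 0 (𝟙 A) _ (hZ.eq_of_src _ _) (by simp) (hZ.eq_of_src _ _)
    (by simp) (by simp)

/-! ### Exact sequences of a conflation -/

section Exact

variable [HasZeroObject C] {A B D W : C} {δ : 𝓔.Ext D A} {x : A ⟶ B} {y : B ⟶ D}
  (hδ : 𝓔.Realizes δ x y)

include hδ

open ZeroObject

theorem comp_eq_zero : x ≫ y = 0 := by
  obtain ⟨c, hc, -⟩ := h.et3 _ _ _ _ _ _ (h.realizes_id (isZero_zero C) (0 : A ⟶ 0)) hδ (𝟙 A) x rfl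
  simpa using hc.symm

theorem exists_lift (f : W ⟶ B) (hf : f ≫ y = 0) : ∃ g : W ⟶ A, g ≫ x = f := by
  obtain ⟨a, ha, -⟩ := h.et3_op _ _ _ _ _ _ (h.realizes_id (isZero_zero C) (0 : W ⟶ 0)) hδ f 0
    (by simp [hf])
  exact ⟨a, by simpa using ha.symm⟩

theorem exists_desc (f : B ⟶ W) (hf : x ≫ f = 0) : ∃ g : D ⟶ W, y ≫ g = f := by
  obtain ⟨c, hc, -⟩ := h.et3 _ _ _ _ _ _ hδ (h.realizes_id' (isZero_zero C) (0 : 0 ⟶ W)) 0 f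
    (by simp [hf])
  exact ⟨c, by simpa using hc⟩

theorem push_eq_zero : 𝓔.push x δ = 0 := by
  obtain ⟨c, -, hc⟩ := h.et3 _ _ _ _ _ _ hδ (h.realizes_id (isZero_zero C) (0 : B ⟶ 0)) x (𝟙 B) rfl
  rw [hc, pull_zero]

theorem pull_eq_zero : 𝓔.pull y δ = 0 := by
  obtain ⟨c, -, hc⟩ := h.et3_op _ _ _ _ _ _ (h.realizes_id' (isZero_zero C) (0 : 0 ⟶ B)) hδ (𝟙 B) y
    rfl
  rw [← hc, push_zero]

theorem exists_extend (f : A ⟶ W) (hf : 𝓔.push f δ = 0) : ∃ g : B ⟶ W, x ≫ g = f := by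
  obtain ⟨b, hb, -⟩ := h.realization _ _ _ _ _ _ hδ (h.realizes_id (isZero_zero C) (0 : W ⟶ 0)) f 0
    (by rw [hf, pull_zero])
  exact ⟨b, by simpa using hb⟩

/-- Exactness of `Hom(W, D) ⟶ 𝔼(W, A) ⟶ 𝔼(W, B)` at `𝔼(W, A)`. -/
theorem exists_pull_eq (ε : 𝓔.Ext W A) (hε : 𝓔.push x ε = 0) : ∃ g : W ⟶ D, 𝓔.pull g δ = ε := by
  obtain ⟨E, i, p, hi⟩ := h.exists_realizes ε
  obtain ⟨b, hb⟩ := h.exists_extend hi x hε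
  obtain ⟨c, -, hc⟩ := h.et3 _ _ _ _ _ _ hi hδ (𝟙 A) b (by simp [hb])
  exact ⟨c, by rw [← hc, push_id]⟩

/-- An endomorphism `b` of the middle term which is the identity on both ends is invertible, since
`(1 - b) ≫ (1 - b) = 0`. -/
theorem isIso_of_comp_eq (b : B ⟶ B) (hx : x ≫ b = x) (hy : b ≫ y = y) : IsIso b := by
  obtain ⟨c, hc⟩ := h.exists_desc hδ (𝟙 B - b) (by simp [hx])
  apply isIso_of_unipotent
  nth_rw 2 [← hc]
  rw [← Category.assoc, Preadditive.sub_comp, Category.id_comp, hy, sub_self, zero_comp]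

/-- Conflations may be transported along isomorphisms of their end terms. -/
theorem conflation_of_iso {A' D' : C} (a : A' ≅ A) (c : D ≅ D') :
    𝓔.Conflation (a.hom ≫ x) (y ≫ c.hom) := by
  refine ⟨𝓔.push a.inv (𝓔.pull c.inv δ), ?_⟩
  obtain ⟨B', x', y', hδ'⟩ := h.exists_realizes (𝓔.push a.inv (𝓔.pull c.inv δ))
  obtain ⟨b, hb, hb'⟩ := h.realization _ _ _ _ _ _ hδ' hδ a.hom c.inv (by
    rw [← push_comp, a.inv_hom_id, push_id])
  obtain ⟨b', hb₁, hb₁'⟩ := h.realization _ _ _ _ _ _ hδ hδ' a.inv c.hom (by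
    rw [← push_pull, ← pull_comp, c.hom_inv_id, pull_id])
  have h₁ : IsIso (b ≫ b') := h.isIso_of_comp_eq hδ' _
    (by rw [reassoc_of% hb, hb₁, a.hom_inv_id_assoc])
    (by rw [Category.assoc, ← hb₁', reassoc_of% hb'.symm, c.inv_hom_id, Category.comp_id])
  have h₂ : IsIso (b' ≫ b) := h.isIso_of_comp_eq hδ _
    (by rw [reassoc_of% hb₁, hb, a.inv_hom_id_assoc])
    (by rw [Category.assoc, ← hb', reassoc_of% hb₁'.symm, c.hom_inv_id, Category.comp_id])
  have : IsIso b := isIso_of_isIso_comp_of_isIso_comp b b'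
  exact (h.realizes_iff _ _ _ _ _ hδ').2 ⟨asIso b, by simpa using hb, by
    simp [← reassoc_of% hb']⟩

/-- The cone of an inflation is unique up to isomorphism. Since deflations need not be epimorphisms,
the comparison morphisms are only mutually inverse up to unipotent endomorphisms. -/
theorem nonempty_iso_cone {D' : C} {y' : B ⟶ D'} (hδ' : 𝓔.Conflation x y') :
    Nonempty (D ≅ D') := by
  obtain ⟨δ', hδ'⟩ := hδ'
  -- An endomorphism of the cone compatible with the identities of `A` and `B` is unipotent.
  have key : ∀ {D : C} {y : B ⟶ D} {δ : 𝓔.Ext D A}, 𝓔.Realizes δ x y → ∀ c : D ⟶ D,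
      y ≫ c = y → 𝓔.pull c δ = δ → IsIso c := by
    intro D y δ hδ c hc hc'
    obtain ⟨b, hb⟩ : ∃ b : D ⟶ B, b ≫ y = 𝟙 D - c := by
      obtain ⟨b, -, hb⟩ := h.realization _ _ _ _ _ _
        (h.realizes_id' (isZero_zero C) (0 : 0 ⟶ D)) hδ 0 (𝟙 D - c) (by
          rw [h.pull_sub_hom, hc', pull_id, sub_self, push_zero])
      exact ⟨b, by simpa using hb.symm⟩
    apply isIso_of_unipotent
    nth_rw 1 [← hb]
    rw [Category.assoc, Preadditive.comp_sub, Category.comp_id, hc, sub_self, comp_zero]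
  obtain ⟨c, hc, hcδ⟩ := h.et3 _ _ _ _ _ _ hδ hδ' (𝟙 A) (𝟙 B) (by simp)
  obtain ⟨c', hc', hcδ'⟩ := h.et3 _ _ _ _ _ _ hδ' hδ (𝟙 A) (𝟙 B) (by simp)
  rw [push_id] at hcδ hcδ'
  rw [Category.id_comp] at hc hc'
  have h₁ : IsIso (c ≫ c') := key hδ _ (by rw [reassoc_of% hc, hc'])
    (by rw [pull_comp, ← hcδ', ← hcδ])
  have h₂ : IsIso (c' ≫ c) := key hδ' _ (by rw [reassoc_of% hc', hc])
    (by rw [pull_comp, ← hcδ, ← hcδ'])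
  have : IsIso c := isIso_of_isIso_comp_of_isIso_comp c c'
  exact ⟨asIso c⟩

/-- If `f ≫ y` is invertible, then the conflation splits and `f` is an inflation with cone `A`. -/
theorem exists_conflation_of_isIso_comp (f : W ⟶ B) [IsIso (f ≫ y)] :
    ∃ c : B ⟶ A, 𝓔.Conflation f c := by
  have hs : (inv (f ≫ y) ≫ f) ≫ y = 𝟙 D := by simp
  generalize hsf : inv (f ≫ y) ≫ f = s at hs
  have hxy := h.comp_eq_zero hδ
  have hδ0 : δ = 0 := by
    rw [← pull_id δ, ← hs, pull_comp, h.pull_eq_zero hδ, pull_zero]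
  obtain ⟨r, hr⟩ := h.exists_extend hδ (𝟙 A) (by rw [hδ0, push_zero])
  obtain ⟨c, hc⟩ := h.exists_lift hδ (𝟙 B - y ≫ s) (by simp [hs])
  have hxc : x ≫ c = 𝟙 A := by
    rw [← hr, ← Category.comp_id (x ≫ c), ← hr]
    simp only [Category.assoc]
    rw [reassoc_of% hc]
    simp [reassoc_of% hxy]
  have hsc : s ≫ c = 0 := by
    rw [← Category.comp_id (s ≫ c), ← hr]
    simp only [Category.assoc]
    rw [reassoc_of% hc]
    simp [reassoc_of% hs]
  have := h.conflation_of_iso (h.realizes_zero_of_splitting s y x c hs hxc hsc hxy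
    (by rw [hc]; abel)) (asIso (f ≫ y)) (Iso.refl A)
  refine ⟨c, ?_⟩
  convert this using 1
  · simp [← hsf]
  · simp

end Exact

/-- The pushout of two inflations out of `A`, obtained by realizing the extension of `D₁ ⊞ D₂` by
`A` whose components are the two given ones. -/
theorem exists_pushout [HasZeroObject C] {A B₁ B₂ D₁ D₂ : C} {x₁ : A ⟶ B₁} {y₁ : B₁ ⟶ D₁}
    {x₂ : A ⟶ B₂} {y₂ : B₂ ⟶ D₂} (h₁ : 𝓔.Conflation x₁ y₁) (h₂ : 𝓔.Conflation x₂ y₂) :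
    ∃ (W : C) (i₁ : B₁ ⟶ W) (p₂ : W ⟶ D₂) (i₂ : B₂ ⟶ W) (p₁ : W ⟶ D₁),
      𝓔.Conflation i₁ p₂ ∧ 𝓔.Conflation i₂ p₁ := by
  obtain ⟨δ₁, h₁⟩ := h₁
  obtain ⟨δ₂, h₂⟩ := h₂
  obtain ⟨W, i, p, hW⟩ :=
    h.exists_realizes (𝓔.pull (biprod.fst : D₁ ⊞ D₂ ⟶ D₁) δ₁ + 𝓔.pull biprod.snd δ₂)
  obtain ⟨K₁, d₁, e₁, k₁, ε₁, -, -, hk₁, hd₁, -⟩ := h.et4_op _ _ _ _ _ _ hW (h.realizes_zero D₁ D₂)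
  have hsplit : 𝓔.Realizes (0 : 𝓔.Ext D₁ D₂) biprod.inr (biprod.fst : D₁ ⊞ D₂ ⟶ D₁) :=
    h.realizes_zero_of_splitting _ biprod.snd biprod.inl _ (by simp) (by simp) (by simp) (by simp)
      (by rw [add_comm]; exact biprod.total)
  obtain ⟨K₂, d₂, e₂, k₂, ε₂, -, -, hk₂, hd₂, -⟩ := h.et4_op _ _ _ _ _ _ hW hsplit
  rw [pull_add, ← pull_comp, ← pull_comp, biprod.inl_fst, biprod.inl_snd, pull_id,
    h.pull_zero_hom, add_zero] at hd₁
  rw [pull_add, ← pull_comp, ← pull_comp, biprod.inr_fst, biprod.inr_snd, pull_id,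
    h.pull_zero_hom, zero_add] at hd₂
  obtain ⟨b₁, -⟩ := (h.realizes_iff _ _ _ _ _ h₁).1 hd₁
  obtain ⟨b₂, -⟩ := (h.realizes_iff _ _ _ _ _ h₂).1 hd₂
  exact ⟨W, _, _, _, _, h.conflation_of_iso hk₁ b₁ (Iso.refl _),
    h.conflation_of_iso hk₂ b₂ (Iso.refl _)⟩

/-- A conflation may be replaced by one with an isomorphic middle term. -/
theorem conflation_of_iso_middle {A B B' D : C} {x : A ⟶ B} {y : B ⟶ D} (hxy : 𝓔.Conflation x y)
    (b : B ≅ B') : 𝓔.Conflation (x ≫ b.hom) (b.inv ≫ y) := by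
  obtain ⟨δ, hδ⟩ := hxy
  exact ⟨δ, (h.realizes_iff _ _ _ _ _ hδ).2 ⟨b, rfl, by simp⟩⟩

end IsExtriangulated

end ExtData

namespace ExtData

/-! ### Filtrations of bounded length -/

section FiltLE

variable {C : Type u} [Category.{v} C]

/-- The objects which admit a filtration with at most `n` steps whose cones lie in `S`. -/
inductive FiltLE (𝓔 : ExtData.{w} C) (S : ObjectProperty C) : ℕ → ObjectProperty C
  | zero (n : ℕ) (M : C) (h : IsZero M) : FiltLE 𝓔 S n M
  | step {n : ℕ} {N M D : C} (f : N ⟶ M) (g : M ⟶ D) (hN : FiltLE 𝓔 S n N)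
      (hfg : 𝓔.Conflation f g) (hD : S D) : FiltLE 𝓔 S (n + 1) M

variable {𝓔 : ExtData.{w} C} {S S' : ObjectProperty C}

theorem FiltLE.mono {n m : ℕ} {M : C} (hM : 𝓔.FiltLE S n M) (hnm : n ≤ m) : 𝓔.FiltLE S m M := by
  induction hM generalizing m with
  | zero n M h => exact .zero _ _ h
  | step f g hN hfg hD ih =>
    obtain ⟨m, rfl⟩ : ∃ l, m = l + 1 := ⟨m - 1, by omega⟩
    exact .step f g (ih (by omega)) hfg hD

theorem FiltLE.filt {n : ℕ} {M : C} (hM : 𝓔.FiltLE S n M) : 𝓔.Filt S M := by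
  induction hM with
  | zero n M h => exact .zero _ h
  | step f g hN hfg hD ih => exact .step f g ih hfg hD

theorem Filt.exists_filtLE {M : C} (hM : 𝓔.Filt S M) : ∃ n, 𝓔.FiltLE S n M := by
  induction hM with
  | zero M h => exact ⟨0, .zero _ _ h⟩
  | step f g hN hfg hD ih =>
    obtain ⟨n, hn⟩ := ih
    exact ⟨n + 1, .step f g hn hfg hD⟩

theorem Filt.mono {M : C} (hM : 𝓔.Filt S M) (hS : S ≤ S') : 𝓔.Filt S' M := by
  induction hM with
  | zero M h => exact .zero _ h
  | step f g hN hfg hD ih => exact .step f g ih hfg (hS _ hD)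

end FiltLE

end ExtData

namespace IsSemibrick

variable {C : Type u} [Category.{v} C] [Preadditive C] {X : ObjectProperty C}

theorem isIso_of_ne_zero (hX : IsSemibrick X) {Y D : C} (hY : X Y) (hD : X D) (u : Y ⟶ D)
    (hu : u ≠ 0) : IsIso u := by
  obtain ⟨φ⟩ : Nonempty (Y ≅ D) := by
    by_contra hn
    exact hu (hX.hom_zero hY hD hn u)
  have hne : (u ≫ φ.inv : Y ⟶ Y) ≠ 0 := fun h0 => hu (by
    rw [← Category.comp_id u, ← φ.inv_hom_id, reassoc_of% h0, zero_comp])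
  have : IsIso (u ≫ φ.inv) := (isUnit_iff_isIso _).1 ((hX.brick hY).2 (u ≫ φ.inv) hne)
  exact IsIso.of_isIso_comp_right u φ.inv

theorem not_isZero (hX : IsSemibrick X) {Y : C} (hY : X Y) : ¬ IsZero Y := fun h =>
  have := (hX.brick hY).1
  not_subsingleton (End Y) ⟨fun _ _ => h.eq_of_src _ _⟩

end IsSemibrick

namespace ExtData

namespace IsExtriangulated

variable {C : Type u} [Category.{v} C] [Preadditive C] [HasBinaryBiproducts C]
  {𝓔 : ExtData.{w} C} (h : 𝓔.IsExtriangulated) {S X : ObjectProperty C}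

include h

theorem filtLE_of_iso {n : ℕ} {M M' : C} (hM : 𝓔.FiltLE S n M) (φ : M ≅ M') :
    𝓔.FiltLE S n M' := by
  cases hM with
  | zero n M h0 => exact .zero _ _ (h0.of_iso φ.symm)
  | step f g hN hfg hD => exact .step _ _ hN (h.conflation_of_iso_middle hfg φ) hD

theorem filt_of_iso {M M' : C} (hM : 𝓔.Filt S M) (φ : M ≅ M') : 𝓔.Filt S M' := by
  obtain ⟨n, hn⟩ := hM.exists_filtLE
  exact (h.filtLE_of_iso hn φ).filt

variable [HasZeroObject C]

/-- In a conflation with zero cone, the inflation is an isomorphism. -/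
theorem isIso_inflation {A B D : C} {x : A ⟶ B} {y : B ⟶ D} (hxy : 𝓔.Conflation x y)
    (hD : IsZero D) : IsIso x := by
  obtain ⟨δ, hδ⟩ := hxy
  obtain ⟨r, hr⟩ := h.exists_lift hδ (𝟙 B) (hD.eq_of_tgt _ _)
  obtain ⟨s, hs⟩ := h.exists_extend hδ (𝟙 A) (by
    rw [push_id, ← pull_id δ, hD.eq_of_src (𝟙 D) 0, h.pull_zero_hom])
  have : IsSplitEpi x := ⟨⟨⟨r, hr⟩⟩⟩
  have : IsSplitMono x := ⟨⟨⟨s, hs⟩⟩⟩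
  exact isIso_of_mono_of_isSplitEpi x

/-- In a conflation with zero first term, the deflation is an isomorphism. -/
theorem isIso_deflation {A B D : C} {x : A ⟶ B} {y : B ⟶ D} (hxy : 𝓔.Conflation x y)
    (hA : IsZero A) : IsIso y := by
  obtain ⟨δ, hδ⟩ := hxy
  have hδ0 : δ = 0 := by rw [← push_id δ, hA.eq_of_src (𝟙 A) 0, h.push_zero_hom]
  obtain ⟨b, -⟩ := (h.realizes_iff _ _ _ _ _ hδ).1 (hδ0 ▸ h.realizes_zero A D)
  obtain ⟨r, hr⟩ := h.exists_desc hδ (𝟙 B) (hA.eq_of_src _ _)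
  obtain ⟨s, -, hs⟩ := h.realization _ _ _ _ _ _ (h.realizes_id' hA (0 : A ⟶ D)) hδ (𝟙 A) (𝟙 D)
    (by rw [push_zero, hδ0, pull_zero])
  have : IsSplitMono y := ⟨⟨⟨r, hr⟩⟩⟩
  have : IsSplitEpi y := ⟨⟨⟨s, by simpa using hs.symm⟩⟩⟩
  exact isIso_of_mono_of_isSplitEpi y

theorem filtLE_of_conflation {n m : ℕ} {N M Q : C} {x : N ⟶ M} {y : M ⟶ Q}
    (hxy : 𝓔.Conflation x y) (hN : 𝓔.FiltLE S n N) (hQ : 𝓔.FiltLE S m Q) :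
    𝓔.FiltLE S (n + m) M := by
  induction hQ generalizing M with
  | zero m Q h0 =>
    have := h.isIso_inflation hxy h0
    exact (h.filtLE_of_iso hN (asIso x)).mono (by omega)
  | step f g hN' hfg hD ih =>
    obtain ⟨δ, hδ⟩ := hxy
    obtain ⟨δ', hδ'⟩ := hfg
    obtain ⟨K, d, e, k, δ'', -, -, hk, hd, -⟩ := h.et4_op _ _ _ _ _ _ hδ hδ'
    exact .step _ _ (ih ⟨_, hd⟩) ⟨_, hk⟩ hD

theorem filt_of_conflation {N M Q : C} {x : N ⟶ M} {y : M ⟶ Q}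
    (hxy : 𝓔.Conflation x y) (hN : 𝓔.Filt S N) (hQ : 𝓔.Filt S Q) : 𝓔.Filt S M := by
  obtain ⟨n, hn⟩ := hN.exists_filtLE
  obtain ⟨m, hm⟩ := hQ.exists_filtLE
  exact (h.filtLE_of_conflation hxy hn hm).filt

theorem filtLE_one [S.IsClosedUnderIsomorphisms] {Y : C} (hY : S Y) : 𝓔.FiltLE S 1 Y :=
  .step 0 (𝟙 Y) (.zero 0 _ (isZero_zero C)) ⟨0, h.realizes_id' (isZero_zero C) _⟩ hY

/-- Filtrations may be read from the bottom: a nonzero filtered object is the middle term of a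
conflation that starts in `S` and whose cone has smaller length. The inflation may be zero. -/
theorem exists_bottom [S.IsClosedUnderIsomorphisms] {n : ℕ} {M : C}
    (hM : 𝓔.FiltLE S n M) : IsZero M ∨ ∃ (m : ℕ) (Y Q : C) (f : Y ⟶ M) (g : M ⟶ Q),
      n = m + 1 ∧ 𝓔.Conflation f g ∧ S Y ∧ 𝓔.FiltLE S m Q := by
  induction hM with
  | zero n M h0 => exact .inl h0
  | @step n N M D f g hN hfg hD ih =>
    refine .inr ?_
    rcases ih with h0 | ⟨m, Y, Q, f', g', rfl, hfg', hY, hQ⟩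
    · have := h.isIso_deflation hfg h0
      exact ⟨n, M, _, 𝟙 M, 0, rfl, ⟨0, h.realizes_id (isZero_zero C) _⟩,
        S.prop_of_iso (asIso g).symm hD, .zero _ _ (isZero_zero C)⟩
    · obtain ⟨δ, hδ⟩ := hfg'
      obtain ⟨δ', hδ'⟩ := hfg
      obtain ⟨K, d, e, k, δ'', -, -, hk, hd, -⟩ := h.et4 _ _ _ _ _ _ hδ hδ'
      exact ⟨m + 1, Y, K, _, _, rfl, ⟨_, hk⟩, hY, .step _ _ hQ ⟨_, hd⟩ hD⟩

/-- Schur's lemma for filtered objects: a nonzero morphism from a member of the semibrick to an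
object filtered by `S ⊆ X` is an inflation, its source lies in `S`, and its cone has smaller
length. -/
theorem exists_cone [S.IsClosedUnderIsomorphisms] (hX : IsSemibrick X) (hS : S ≤ X)
    {n : ℕ} {M Y : C} (hM : 𝓔.FiltLE S n M) (hY : X Y) (f : Y ⟶ M) (hf : f ≠ 0) :
    ∃ m, n = m + 1 ∧ S Y ∧ ∃ (Q : C) (z : M ⟶ Q), 𝓔.Conflation f z ∧ 𝓔.FiltLE S m Q := by
  induction hM with
  | zero n M h0 => exact (hf (h0.eq_of_tgt _ _)).elim
  | @step n N M D j p hN hjp hD ih =>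
    refine ⟨n, rfl, ?_⟩
    obtain ⟨δ, hδ⟩ := hjp
    by_cases hfp : f ≫ p = 0
    · obtain ⟨g, rfl⟩ := h.exists_lift hδ f hfp
      obtain ⟨m, rfl, hSY, Q, z, ⟨δ', hδ'⟩, hQ⟩ := ih g (fun h0 => hf (by rw [h0, zero_comp]))
      obtain ⟨K, d, e, k, δ'', -, -, hk, hd, -⟩ := h.et4 _ _ _ _ _ _ hδ' hδ
      exact ⟨hSY, K, k, ⟨_, hk⟩, .step _ _ hQ ⟨_, hd⟩ hD⟩
    · have := hX.isIso_of_ne_zero hY (hS _ hD) _ hfp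
      obtain ⟨c, hc⟩ := h.exists_conflation_of_isIso_comp hδ f
      exact ⟨S.prop_of_iso (asIso (f ≫ p)).symm hD, N, c, hc, hN⟩

end IsExtriangulated
end ExtData

namespace ExtData
namespace IsExtriangulated

variable {C : Type u} [Category.{v} C] [Preadditive C] [HasBinaryBiproducts C] [HasZeroObject C]
  {𝓔 : ExtData.{w} C} (h : 𝓔.IsExtriangulated) {S X : ObjectProperty C}

include h

/-! ### Direct summands of filtered objects -/

/-- Idempotents of filtered objects split, without increasing the length. By induction: for an
idempotent `e` of `M` and a conflation `Y ⟶ M ⟶ Q` with `Y ∈ S`, either `e` factors through `Q`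
and has the image of an idempotent of `Q`, or the inflation `Y ⟶ M` can be replaced by one which
is fixed by `e`. -/
theorem exists_splitting [S.IsClosedUnderIsomorphisms] (hX : IsSemibrick X) (hS : S ≤ X)
    {n : ℕ} {M : C} (hM : 𝓔.FiltLE S n M) (e : M ⟶ M) (he : e ≫ e = e) :
    ∃ (L : C) (i : L ⟶ M) (p : M ⟶ L), 𝓔.FiltLE S n L ∧ i ≫ p = 𝟙 L ∧ p ≫ i = e := by
  induction n generalizing M with
  | zero =>
    have h0 : IsZero M := by
      cases hM
      assumption
    exact ⟨M, 𝟙 M, 𝟙 M, hM, by simp, h0.eq_of_src _ _⟩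
  | succ n ih =>
    rcases h.exists_bottom hM with h0 | ⟨m, Y, Q, f, y, hm, ⟨δ, hδ⟩, hY, hQ⟩
    · exact ⟨M, 𝟙 M, 𝟙 M, hM, by simp, h0.eq_of_src _ _⟩
    obtain rfl : n = m := by omega
    by_cases hfe : f ≫ e = 0
    · -- Here `e = y ≫ t`, so that `e` and the idempotent `t ≫ e ≫ y` of `Q` have the same image.
      obtain ⟨t, ht⟩ := h.exists_desc hδ e hfe
      obtain ⟨L, i, p, hL, hip, hpi⟩ := ih hQ (t ≫ e ≫ y) (by
        simp only [Category.assoc]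
        rw [reassoc_of% ht, reassoc_of% he, reassoc_of% he])
      refine ⟨L, i ≫ t ≫ e, y ≫ p, hL.mono (Nat.le_succ n), ?_, ?_⟩
      · have : i ≫ (t ≫ e ≫ y) ≫ p = 𝟙 L := by rw [← hpi]; simp [hip]
        simpa using this
      · simp only [Category.assoc]
        rw [reassoc_of% hpi, reassoc_of% ht, reassoc_of% he, reassoc_of% ht, he, he]
    · obtain ⟨m, hm', -, Q, z, ⟨δ, hδ⟩, hQ⟩ := h.exists_cone hX hS hM (hS _ hY) _ hfe
      obtain rfl : n = m := by omega
      generalize hg : f ≫ e = g at hδ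
      have hge : g ≫ e = g := by rw [← hg, Category.assoc, he]
      obtain ⟨t', ht'⟩ := h.exists_desc hδ (𝟙 M - e) (by simp [hge])
      have hq : (𝟙 M - e) ≫ (𝟙 M - e) = 𝟙 M - e := by simp [he]
      obtain ⟨t, ht, hte⟩ : ∃ t : Q ⟶ M, z ≫ t = 𝟙 M - e ∧ t ≫ (𝟙 M - e) = t :=
        ⟨t' ≫ (𝟙 M - e), by rw [reassoc_of% ht', hq], by rw [Category.assoc, hq]⟩
      obtain ⟨L', i, p, hL', hip, hpi⟩ := ih hQ (𝟙 Q - t ≫ z) (by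
        have : t ≫ z ≫ t ≫ z = t ≫ z := by rw [reassoc_of% ht, reassoc_of% hte]
        simp [this])
      have hδ' : 𝓔.pull (p ≫ i) δ = δ := by
        rw [hpi, h.pull_sub_hom, pull_id, pull_comp, h.pull_eq_zero hδ, pull_zero, sub_zero]
      obtain ⟨L, g₁, z₁, hL⟩ := h.exists_realizes (𝓔.pull i δ)
      obtain ⟨a, ha, ha'⟩ := h.realization _ _ _ _ _ _ hL hδ (𝟙 Y) i (push_id _)
      obtain ⟨b, hb, hb'⟩ := h.realization _ _ _ _ _ _ hδ hL (𝟙 Y) p (by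
        rw [push_id, ← pull_comp, hδ'])
      rw [Category.id_comp] at ha hb
      have hez : e ≫ z = z ≫ p ≫ i := by
        have : e = 𝟙 M - z ≫ t := by rw [ht]; abel
        rw [hpi, this]; simp
      have hipi : i ≫ p ≫ i = i := by rw [reassoc_of% hip]
      have hpip : p ≫ i ≫ p = p := by rw [hip, Category.comp_id]
      -- Both endomorphisms below are the identity on the ends of their conflations. By the first
      -- one `L` is a summand of the image of `e`, by the second one it is the whole image.
      have hu : IsIso (a ≫ e ≫ b) := h.isIso_of_comp_eq hL _
        (by rw [reassoc_of% ha, reassoc_of% hge, hb])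
        (by
          simp only [Category.assoc]
          rw [← hb', reassoc_of% hez, hpip, reassoc_of% ha'.symm, hip, Category.comp_id])
      have hw : IsIso (e ≫ b ≫ a ≫ e + (𝟙 M - e)) := h.isIso_of_comp_eq hδ _
        (by simp [reassoc_of% hge, reassoc_of% hb, reassoc_of% ha, hge])
        (by
          simp only [Preadditive.add_comp, Preadditive.sub_comp, Category.assoc, Category.id_comp]
          rw [hez, reassoc_of% ha'.symm, reassoc_of% hb'.symm, hipi, reassoc_of% hez, hipi]
          abel)
      refine ⟨L, inv (a ≫ e ≫ b) ≫ a ≫ e, e ≫ b, ?_, ?_, ?_⟩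
      · have := h.filtLE_of_conflation ⟨_, hL⟩ (h.filtLE_one hY) hL'
        rwa [add_comm] at this
      · simp only [Category.assoc, reassoc_of% he]
        simp
      · rw [← cancel_epi (e ≫ b ≫ a ≫ e + (𝟙 M - e))]
        have h₁ : (a ≫ e ≫ b) ≫ inv (a ≫ e ≫ b) ≫ a ≫ e = a ≫ e := by simp
        simp only [Category.assoc] at h₁
        simp only [Preadditive.add_comp, Preadditive.sub_comp, Category.assoc, Category.id_comp,
          reassoc_of% he, he, h₁, sub_self]

theorem filtLE_of_retract [S.IsClosedUnderIsomorphisms] (hX : IsSemibrick X) (hS : S ≤ X)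
    {n : ℕ} {M A : C} (hM : 𝓔.FiltLE S n M) (s : A ⟶ M) (r : M ⟶ A) (hsr : s ≫ r = 𝟙 A) :
    𝓔.FiltLE S n A := by
  obtain ⟨L, i, p, hL, hip, hpi⟩ := h.exists_splitting hX hS hM (r ≫ s) (by simp [reassoc_of% hsr])
  refine h.filtLE_of_iso hL ⟨i ≫ r, s ≫ p, ?_, ?_⟩
  · have : i ≫ (r ≫ s) ≫ p = 𝟙 L := by rw [← hpi]; simp [hip]
    simpa using this
  · simp [reassoc_of% hpi, hsr]

theorem filt_of_retract [S.IsClosedUnderIsomorphisms] (hX : IsSemibrick X) (hS : S ≤ X)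
    {M A : C} (hM : 𝓔.Filt S M) (s : A ⟶ M) (r : M ⟶ A) (hsr : s ≫ r = 𝟙 A) :
    𝓔.Filt S A := by
  obtain ⟨n, hn⟩ := hM.exists_filtLE
  exact (h.filtLE_of_retract hX hS hn s r hsr).filt

/-! ### Intersections of filtration subcategories -/

/-- `Filt` commutes with intersections of subsets of a semibrick. -/
theorem filt_sInf (hX : IsSemibrick X) (𝒮 : Set (ObjectProperty C))
    (h𝒮 : ∀ S ∈ 𝒮, IsSubset X S) {M : C} (hM : 𝓔.Filt X M) (hM' : ∀ S ∈ 𝒮, 𝓔.Filt S M) :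
    𝓔.Filt (fun Y => X Y ∧ ∀ S ∈ 𝒮, S Y) M := by
  have := hX.iso_closed
  have hcl : ObjectProperty.IsClosedUnderIsomorphisms (fun Y : C => X Y ∧ ∀ S ∈ 𝒮, S Y) :=
    ⟨fun φ hY => ⟨X.prop_of_iso φ hY.1, fun S hS =>
      have := (h𝒮 S hS).1
      S.prop_of_iso φ (hY.2 S hS)⟩⟩
  obtain ⟨n, hn⟩ := hM.exists_filtLE
  clear hM
  induction n generalizing M with
  | zero => cases hn with | zero _ _ h0 => exact .zero _ h0
  | succ n ih =>
    rcases h.exists_bottom hn with h0 | ⟨m, Y, Q, f, y, hm, hfy, hY, hQ⟩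
    · exact .zero _ h0
    obtain rfl : n = m := by omega
    obtain ⟨δ, hδ⟩ := hfy
    by_cases hf : f = 0
    · -- Then `y` is a split monomorphism, so that `M` is a summand of the shorter object `Q`.
      obtain ⟨t, ht⟩ := h.exists_desc hδ (𝟙 M) (by rw [hf, zero_comp])
      exact ih hM' (h.filtLE_of_retract hX le_rfl hQ y t ht)
    · have key : ∀ S ∈ 𝒮, S Y ∧ 𝓔.Filt S Q := by
        intro S hS
        have := (h𝒮 S hS).1
        obtain ⟨l, hl⟩ := (hM' S hS).exists_filtLE
        obtain ⟨m, -, hSY, Q', z, hz, hQ'⟩ := h.exists_cone hX (h𝒮 S hS).2 hl hY f hf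
        obtain ⟨φ⟩ := h.nonempty_iso_cone hδ hz
        exact ⟨hSY, h.filt_of_iso hQ'.filt φ.symm⟩
      exact h.filt_of_conflation ⟨δ, hδ⟩ (h.filtLE_one ⟨hY, fun S hS => (key S hS).1⟩).filt
        (ih (fun S hS => (key S hS).2) hQ)

theorem le_of_filt_le [S.IsClosedUnderIsomorphisms] (hX : IsSemibrick X) (hS : S ≤ X)
    {S' : ObjectProperty C} (hS' : IsSubset X S') (hle : ∀ M, 𝓔.Filt S M → 𝓔.Filt S' M) :
    S ≤ S' := by
  intro Y hY
  have := hS'.1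
  obtain ⟨n, hn⟩ := (hle Y (h.filtLE_one hY).filt).exists_filtLE
  obtain ⟨m, -, hSY, -⟩ := h.exists_cone hX hS'.2 hn (hS _ hY) (𝟙 Y)
    (fun h0 => hX.not_isZero (hS _ hY) ((IsZero.iff_id_eq_zero Y).2 h0))
  exact hSY

/-! ### Torsion pairs and approximations -/

theorem eq_zero_of_filt {M F : C} (hM : 𝓔.Filt S M) (hF : ∀ Y, S Y → ∀ f : Y ⟶ F, f = 0)
    (f : M ⟶ F) : f = 0 := by
  induction hM with
  | zero M h0 => exact h0.eq_of_src _ _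
  | step j p hN hjp hD ih =>
    obtain ⟨δ, hδ⟩ := hjp
    obtain ⟨c, rfl⟩ := h.exists_desc hδ f (ih _)
    rw [hF _ hD c, comp_zero]

/-- The torsion sequence of `M` with respect to `Filt(S)`: an `S`-filtered subobject `t` such that
the cone `F` receives no nonzero morphism from `S`. -/
theorem exists_torsion [S.IsClosedUnderIsomorphisms] (hX : IsSemibrick X) (hS : S ≤ X)
    {n : ℕ} {M : C} (hM : 𝓔.FiltLE X n M) :
    ∃ (t F : C) (x : t ⟶ M) (y : M ⟶ F), 𝓔.Conflation x y ∧ 𝓔.Filt S t ∧ 𝓔.Filt X F ∧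
      ∀ Y, S Y → ∀ f : Y ⟶ F, f = 0 := by
  have := hX.iso_closed
  induction n generalizing M with
  | zero =>
    cases hM with
    | zero _ _ h0 =>
      exact ⟨M, M, _, _, ⟨0, h.realizes_id h0 (𝟙 M)⟩, .zero _ h0, .zero _ h0,
        fun _ _ _ => h0.eq_of_tgt _ _⟩
  | succ n ih =>
    by_cases hz : ∀ Y, S Y → ∀ f : Y ⟶ M, f = 0
    · exact ⟨_, M, _, _, ⟨0, h.realizes_id' (isZero_zero C) 0⟩, .zero _ (isZero_zero C), hM.filt,
        hz⟩
    · push Not at hz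
      obtain ⟨Y, hY, f, hf⟩ := hz
      obtain ⟨m, hm, -, Q, z, ⟨δ, hδ⟩, hQ⟩ := h.exists_cone hX le_rfl hM (hS _ hY) f hf
      obtain rfl : n = m := by omega
      obtain ⟨t, F, x, y, ⟨δ', hδ'⟩, ht, hF, hF'⟩ := ih hQ
      obtain ⟨K, d, e, k, δ'', -, -, hk, hd, -⟩ := h.et4_op _ _ _ _ _ _ hδ hδ'
      exact ⟨K, F, _, _, ⟨_, hk⟩, h.filt_of_conflation ⟨_, hd⟩ (h.filtLE_one hY).filt ht, hF, hF'⟩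

/-- The special preenvelope of `M`: for a conflation `M ⟶ I ⟶ N` with `𝔼(Filt(S), I) = 0`, the
preimage `V` in `I` of the torsion part of `N` with respect to `Filt(S)`. -/
theorem exists_right_approx [S.IsClosedUnderIsomorphisms] (hX : IsSemibrick X) (hS : S ≤ X)
    {M I N : C} {x : M ⟶ I} {y : I ⟶ N} (hxy : 𝓔.Conflation x y) (hN : 𝓔.Filt X N)
    (hI : 𝓔.rightPerp (𝓔.Filt S) I) :
    ∃ (V t : C) (i : M ⟶ V) (p : V ⟶ t), 𝓔.rightPerp (𝓔.Filt S) V ∧ 𝓔.Filt S t ∧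
      𝓔.Conflation i p := by
  obtain ⟨n, hn⟩ := hN.exists_filtLE
  obtain ⟨δ, hδ⟩ := hxy
  obtain ⟨t, F, i, p, ⟨δ', hδ'⟩, ht, -, hF⟩ := h.exists_torsion hX hS hn
  obtain ⟨V, d, e, k, δ'', -, -, hk, hd, -⟩ := h.et4_op _ _ _ _ _ _ hδ hδ'
  refine ⟨V, t, d, e, fun U hU ε => ?_, ht, _, hd⟩
  obtain ⟨g, hg⟩ := h.exists_pull_eq hk ε (hI hU _)
  rw [← hg, h.eq_zero_of_filt hU hF g, h.pull_zero_hom]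

end IsExtriangulated
end ExtData

namespace ExtData

/-! ### Filtration subcategories of `T = Filt(X)` -/

section Restrict

variable {C : Type u} [Category.{v} C] {𝓔 : ExtData.{w} C} {S X : ObjectProperty C}

theorem rightPerp_of_retract {U : ObjectProperty C} {M A : C} (hM : 𝓔.rightPerp U M) (s : A ⟶ M)
    (r : M ⟶ A) (hsr : s ≫ r = 𝟙 A) : 𝓔.rightPerp U A := by
  intro N hN δ
  rw [← push_id δ, ← hsr, push_comp, hM hN (𝓔.push s δ), push_zero]

variable [Preadditive C]

theorem filt_obj_of_filtIn {M : 𝓔.FiltCat X} (hM : 𝓔.FiltIn X S M) : 𝓔.Filt S M.obj := by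
  induction hM with
  | zero M h0 =>
    exact .zero _ ((IsZero.iff_id_eq_zero _).2
      (congrArg InducedCategory.Hom.hom ((IsZero.iff_id_eq_zero M).1 h0)))
  | step f g hN hfg hD ih => exact .step f.hom g.hom ih hfg hD

end Restrict

namespace IsExtriangulated

variable {C : Type u} [Category.{v} C] [Preadditive C] [HasBinaryBiproducts C] [HasZeroObject C]
  {𝓔 : ExtData.{w} C} (h : 𝓔.IsExtriangulated) {S X : ObjectProperty C}

include h

theorem filtIn_iff (hX : IsSemibrick X) (hS : S ≤ X) (M : 𝓔.FiltCat X) :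
    𝓔.FiltIn X S M ↔ 𝓔.Filt S M.obj := by
  have := hX.iso_closed
  refine ⟨filt_obj_of_filtIn, ?_⟩
  obtain ⟨M, hM⟩ := M
  intro hM'
  dsimp only at hM'
  induction hM' with
  | zero M h0 =>
    exact .zero _ ((IsZero.iff_id_eq_zero _).2 (ObjectProperty.hom_ext _
      ((IsZero.iff_id_eq_zero M).1 h0)))
  | @step N M D f g hN hfg hD ih =>
    let f' : (⟨N, hN.mono hS⟩ : 𝓔.FiltCat X) ⟶ ⟨M, hM⟩ := ObjectProperty.homMk f
    let g' : (⟨M, hM⟩ : 𝓔.FiltCat X) ⟶ ⟨D, (h.filtLE_one (hS _ hD)).filt⟩ :=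
      ObjectProperty.homMk g
    exact Filt.step f' g' (ih (hN.mono hS)) hfg hD

theorem rightPerp_filtIn_iff (hX : IsSemibrick X) (hS : S ≤ X) (M : 𝓔.FiltCat X) :
    (𝓔.filtData X).rightPerp (𝓔.FiltIn X S) M ↔ 𝓔.rightPerp (𝓔.Filt S) M.obj := by
  constructor
  · intro hM N hN
    exact hM (N := ⟨N, hN.mono hS⟩) ((h.filtIn_iff hX hS _).2 hN)
  · intro hM N hN
    exact hM ((h.filtIn_iff hX hS _).1 hN)

theorem filtIn_le_iff (hX : IsSemibrick X) {S' : ObjectProperty C} (hS : IsSubset X S)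
    (hS' : IsSubset X S') : 𝓔.FiltIn X S ≤ 𝓔.FiltIn X S' ↔ S ≤ S' := by
  constructor
  · intro hle
    have := hS.1
    exact h.le_of_filt_le hX hS.2 hS' fun M hM => (h.filtIn_iff hX hS'.2 ⟨M, hM.mono hS.2⟩).1
      (hle _ ((h.filtIn_iff hX hS.2 _).2 hM))
  · intro hle M hM
    exact (h.filtIn_iff hX hS'.2 M).2 (((h.filtIn_iff hX hS.2 M).1 hM).mono hle)

theorem existsUnique_isSupport (hX : IsSemibrick X) (D : ObjectProperty (𝓔.FiltCat X)) :
    ∃! S : ObjectProperty C, 𝓔.IsSupport X D S := by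
  have := hX.iso_closed
  let 𝒮 : Set (ObjectProperty C) := {S | IsSubset X S ∧ D ≤ 𝓔.FiltIn X S}
  let S₀ : ObjectProperty C := fun Y => X Y ∧ ∀ S ∈ 𝒮, S Y
  have hS₀ : IsSubset X S₀ := by
    refine ⟨⟨fun φ hY => ⟨X.prop_of_iso φ hY.1, fun S hS => ?_⟩⟩, fun Y hY => hY.1⟩
    have := hS.1.1
    exact S.prop_of_iso φ (hY.2 S hS)
  refine ⟨S₀, ⟨hS₀, fun M hM => ?_, ?_⟩, ?_⟩
  · exact (h.filtIn_iff hX hS₀.2 M).2 (h.filt_sInf hX 𝒮 (fun S hS => hS.1) M.property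
      fun S hS => (h.filtIn_iff hX hS.1.2 M).1 (hS.2 M hM))
  · rintro U ⟨S, hS, rfl⟩ hD
    exact (h.filtIn_le_iff hX hS₀ hS).2 fun Y hY => hY.2 S ⟨hS, hD⟩
  · intro S hS
    refine le_antisymm (fun Y hY => ⟨hS.1.2 Y hY, fun S' hS' => ?_⟩)
      fun Y hY => hY.2 S ⟨hS.1, hS.2.1⟩
    exact (h.filtIn_le_iff hX hS.1 hS'.1).1 (hS.2.2 _ ⟨S', hS'.1, rfl⟩ hS'.2) Y hY

theorem isSupport_support (hX : IsSemibrick X) (D : ObjectProperty (𝓔.FiltCat X)) :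
    𝓔.IsSupport X D (𝓔.support X D) :=
  Classical.epsilon_spec (h.existsUnique_isSupport hX D).exists

theorem support_filtIn (hX : IsSemibrick X) (hS : IsSubset X S) :
    𝓔.support X (𝓔.FiltIn X S) = S :=
  (h.existsUnique_isSupport hX _).unique (h.isSupport_support hX _)
    ⟨hS, le_rfl, fun _ _ hU => hU⟩

theorem support_le_iff (hX : IsSemibrick X) (hS : IsSubset X S)
    (D : ObjectProperty (𝓔.FiltCat X)) : 𝓔.support X D ≤ S ↔ D ≤ 𝓔.FiltIn X S := by
  have hD := h.isSupport_support hX D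
  rw [← h.filtIn_le_iff hX hD.1 hS]
  exact ⟨fun hle => hD.2.1.trans hle, fun hle => hD.2.2 _ ⟨S, hS, rfl⟩ hle⟩

/-! ### Cotorsion pairs -/

theorem ext_eq_zero_of_injective {N I : 𝓔.FiltCat X} (hI : (𝓔.filtData X).injectives I)
    (ε : 𝓔.Ext N.obj I.obj) : ε = 0 := by
  obtain ⟨B, x, y, hε⟩ := h.exists_realizes ε
  let B' : 𝓔.FiltCat X := ⟨B, h.filt_of_conflation ⟨_, hε⟩ I.property N.property⟩
  let x' : I ⟶ B' := ObjectProperty.homMk x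
  let y' : B' ⟶ N := ObjectProperty.homMk y
  obtain ⟨b, hb⟩ := hI x' y' ⟨ε, hε⟩ (𝟙 I)
  have hb' : x ≫ b.hom = 𝟙 I.obj := congrArg InducedCategory.Hom.hom hb
  rw [← push_id ε, ← hb', push_comp, h.push_eq_zero hε, push_zero]

theorem projectives_le_of_isCotorsionPair (hX : IsSemibrick X) (hS : IsSubset X S)
    {V : ObjectProperty (𝓔.FiltCat X)}
    (hU : IsCotorsionPair (𝓔.filtData X) (𝓔.FiltIn X S) V) :
    (𝓔.filtData X).projectives ≤ 𝓔.FiltIn X S := by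
  intro P hP
  have := hS.1
  obtain ⟨V₀, U₀, x, y, -, hU₀, hxy⟩ := hU.left_approx P
  obtain ⟨s, hs⟩ := hP x y hxy (𝟙 P)
  exact (h.filtIn_iff hX hS.2 P).2 (h.filt_of_retract hX hS.2 ((h.filtIn_iff hX hS.2 _).1 hU₀)
    s.hom y.hom (congrArg InducedCategory.Hom.hom hs))

theorem exists_right_approx_of_enoughInj (hX : IsSemibrick X) (hS : IsSubset X S)
    (hI : (𝓔.filtData X).EnoughInj) (M : 𝓔.FiltCat X) :
    ∃ (V t : C) (i : M.obj ⟶ V) (p : V ⟶ t), 𝓔.rightPerp (𝓔.Filt S) V ∧ 𝓔.Filt S t ∧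
      𝓔.Conflation i p := by
  have := hS.1
  obtain ⟨I, N, x, y, hI, hxy⟩ := hI M
  exact h.exists_right_approx hX hS.2 (x := x.hom) (y := y.hom) hxy N.property
    fun U hU ε => h.ext_eq_zero_of_injective (N := ⟨U, hU.mono hS.2⟩) hI ε

/-- The left approximations come from the right ones by Salce's pushout argument, which needs
`Filt(S)` to contain the projectives. -/
theorem isCotorsionPair_filtIn (hX : IsSemibrick X) (hS : IsSubset X S)
    (hP : (𝓔.filtData X).EnoughProj) (hI : (𝓔.filtData X).EnoughInj)
    (hPS : (𝓔.filtData X).projectives ≤ 𝓔.FiltIn X S) :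
    IsCotorsionPair (𝓔.filtData X) (𝓔.FiltIn X S)
      ((𝓔.filtData X).rightPerp (𝓔.FiltIn X S)) := by
  have := hS.1
  refine ⟨fun A B b _ hb => ?_, fun A B b _ hb => ?_, fun M N hM hN => hN hM, fun M => ?_,
    fun M => ?_⟩
  · rw [h.filtIn_iff hX hS.2] at hb
    rw [h.filtIn_iff hX hS.2, h.filtIn_iff hX hS.2]
    exact ⟨h.filt_of_retract hX hS.2 hb b.inl.hom b.fst.hom
        (congrArg InducedCategory.Hom.hom b.inl_fst),
      h.filt_of_retract hX hS.2 hb b.inr.hom b.snd.hom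
        (congrArg InducedCategory.Hom.hom b.inr_snd)⟩
  · exact ⟨rightPerp_of_retract hb _ _ b.inl_fst, rightPerp_of_retract hb _ _ b.inr_snd⟩
  · obtain ⟨K, P, x, y, hPP, hxy⟩ := hP M
    obtain ⟨V, t, i, p, hV, ht, hip⟩ := h.exists_right_approx_of_enoughInj hX hS hI K
    obtain ⟨W, i₁, p₂, i₂, p₁, h₁, h₂⟩ := h.exists_pushout (x₁ := x.hom) (y₁ := y.hom) hxy hip
    have hW : 𝓔.Filt S W :=
      h.filt_of_conflation h₁ ((h.filtIn_iff hX hS.2 P).1 (hPS P hPP)) ht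
    have hVX : 𝓔.Filt X V := h.filt_of_conflation hip K.property (ht.mono hS.2)
    exact ⟨⟨V, hVX⟩, ⟨W, hW.mono hS.2⟩, ObjectProperty.homMk i₂, ObjectProperty.homMk p₁,
      (h.rightPerp_filtIn_iff hX hS.2 _).2 hV, (h.filtIn_iff hX hS.2 _).2 hW, h₂⟩
  · obtain ⟨V, t, i, p, hV, ht, hip⟩ := h.exists_right_approx_of_enoughInj hX hS hI M
    have hVX : 𝓔.Filt X V := h.filt_of_conflation hip M.property (ht.mono hS.2)
    exact ⟨⟨V, hVX⟩, ⟨t, ht.mono hS.2⟩, ObjectProperty.homMk i, ObjectProperty.homMk p,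
      (h.rightPerp_filtIn_iff hX hS.2 _).2 hV, (h.filtIn_iff hX hS.2 _).2 ht, hip⟩

end IsExtriangulated
end ExtData

theorem mainTheorem2 {k : Type*} [Field k] {C : Type u} [Category.{v} C] [Preadditive C]
    [HasFiniteBiproducts C] [HasBinaryBiproducts C] [Linear k C]
    (hfin : ∀ A B : C, Module.Finite k (A ⟶ B)) (hKS : IsKrullSchmidt C)
    (𝓔 : ExtData.{w} C) (h𝓔 : 𝓔.IsExtriangulated)
    (X : ObjectProperty C) (hX : IsSemibrick X)
    (hP : (𝓔.filtData X).EnoughProj) (hI : (𝓔.filtData X).EnoughInj) :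
    (∀ D : ObjectProperty (𝓔.FiltCat X), ∃! S : ObjectProperty C, 𝓔.IsSupport X D S) ∧
    Set.BijOn (𝓔.support X) (𝓔.cotorsionFiltrations X) (𝓔.subsetsContainingProj X) ∧
    Set.BijOn (𝓔.FiltIn X) (𝓔.subsetsContainingProj X) (𝓔.cotorsionFiltrations X) ∧
    Set.InvOn (𝓔.FiltIn X) (𝓔.support X)
      (𝓔.cotorsionFiltrations X) (𝓔.subsetsContainingProj X) := by
  have h₁ : Set.MapsTo (𝓔.support X) (𝓔.cotorsionFiltrations X) (𝓔.subsetsContainingProj X) := by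
    rintro _ ⟨⟨S, hS, rfl⟩, hU⟩
    rw [h𝓔.support_filtIn hX hS]
    exact ⟨hS, (h𝓔.support_le_iff hX hS _).2 (h𝓔.projectives_le_of_isCotorsionPair hX hS hU)⟩
  have h₂ : Set.MapsTo (𝓔.FiltIn X) (𝓔.subsetsContainingProj X) (𝓔.cotorsionFiltrations X) := by
    rintro S ⟨hS, hPS⟩
    exact ⟨⟨S, hS, rfl⟩,
      h𝓔.isCotorsionPair_filtIn hX hS hP hI ((h𝓔.support_le_iff hX hS _).1 hPS)⟩
  have h₃ : Set.InvOn (𝓔.FiltIn X) (𝓔.support X)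
      (𝓔.cotorsionFiltrations X) (𝓔.subsetsContainingProj X) := by
    constructor
    · rintro _ ⟨⟨S, hS, rfl⟩, -⟩
      rw [h𝓔.support_filtIn hX hS]
    · rintro S ⟨hS, -⟩
      exact h𝓔.support_filtIn hX hS
  exact ⟨h𝓔.existsUnique_isSupport hX, h₃.bijOn h₁ h₂, h₃.symm.bijOn h₂ h₁, h₃⟩
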